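/- **Setting.** Let $M$ be a connected compact smooth manifold of dimension $N$, possibly with boundary or corners, with a continuous spacetime structure: a continuous Lorentzian metric $g$ of signature $(-,+,\dots,+)$ and a time orientation given by a continuous timelike vector field $T$. Let $d$ be the distance of any (continuous, in particular any smooth) Riemannian metric on $M$; since $M$ is compact, $d$ is complete. A future-directed causal (timelike) curve is a Lipschitz curve $\gamma:[a,b]\to M$, $a<b$, such that for almost every $t$ the velocity $\dot\gamma(t)$ exists and satisfies $g(\dot\gamma,\dot\gamma)\le 0$ (respectively $<0$) and $g(T,\dot\gamma)<0$. Write $x\le y$ if $x=y$ or there is a future-directed causal curve from $x$ to $y$; write $x<y$ if $x\le y$ and $x\ne y$; write $x\ll y$ if there is a future-directed timelike curve from $x$ to $y$. Put $$J(x,y)=\{z: x\le z\le y\},\qquad I(x,y)=\{z: x\ll z\ll y\},$$ and let $$\tau(x,y)=\sup_\gamma\int_a^b\sqrt{-g(\dot\gamma,\dot\gamma)}\,dt\in[0,\infty]$$ be the supremum over all future-directed causal curves $\gamma$ from $x$ to $y$, with $\tau(x,y)=0$ if there are none. Let $\rho_N(J(x,y))=\omega_N\,\tau(x,y)^N$ (and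 $=\infty$ if $\tau(x,y)=\infty$), where $\omega_N=\dfrac{\pi^{(N-1)/2}}{N\,\Gamma(\frac{N+1}{2})\,2^{N-1}}$, and let $\rho_N(\emptyset)=0$. For $A\subseteq M$ and $\delta>0$ let $\mathcal V^N_\delta(A)$ (respectively $\mathcal W^N_\delta(A)$) be the infimum of $\sum_{i=1}^\infty\rho_N(A_i)$ over all sequences $(A_i)$ with $A\subseteq\bigcup_i A_i$ in which each $A_i$ is either empty or a causal diamond $A_i=J(a_i,b_i)$ with $a_i<b_i$ and $\mathrm{diam}_d\,J(a_i,b_i)<\delta$ (respectively $d(a_i,b_i)<\delta$); here $\inf\emptyset=\infty$. Put $\mathcal V^N=\sup_{\delta>0}\mathcal V^N_\delta$ and $\mathcal W^N=\sup_{\delta>0}\mathcal W^N_\delta$. **Theorem.** Suppose that $M$ is strongly causal in at least one of the following two senses: * every neighbourhood $U$ of every point contains a neighbourhood $V$ of that point such that every causal curve with both endpoints in $V$ stays in $U$; or * the Alexandrov topology (the topology with subbase $\{I(x,y):x,y\in M\}$) is the manifold topology. Then $\mathcal W^N(A)=\mathcal V^N(A)$ for every subset $A\subseteq M$. Moreover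 $\mathrm{diam}_d\,J(x,y)\to0$ uniformly as $d(x,y)\to0$: for every $\varepsilon>0$ there is $\delta>0$ such that $\mathrm{diam}_d\,J(x,y)\le\varepsilon$ for all $x,y\in M$ with $d(x,y)<\delta$. -/

import Mathlib

open Set MeasureTheory Topology Bundle Manifold
open scoped ENNReal ContDiff

noncomputable section

/-- The structure of a continuous (time-oriented) spacetime on an `N`-dimensional smooth manifold,
possibly with boundary or corners: a continuous Lorentzian metric of signature `(-,+,…,+)` and a
time orientation, given by a continuous timelike vector field that is declared future directed. -/
structure ContinuousSpacetime {N : ℕ} {H : Type*} [TopologicalSpace H]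
    (I : ModelWithCorners ℝ (EuclideanSpace ℝ (Fin N)) H)
    (M : Type*) [TopologicalSpace M] [ChartedSpace H M] [IsManifold I ∞ M] where
  /-- The Lorentzian metric. -/
  metric : ∀ x : M, TangentSpace I x →L[ℝ] TangentSpace I x →L[ℝ] ℝ
  metric_symm : ∀ (x : M) (v w : TangentSpace I x), metric x v w = metric x w v
  /-- Signature `(-,+,…,+)`: there is a timelike vector on whose orthogonal complement the form
  is positive definite. -/
  metric_lorentzian : ∀ x : M, ∃ v : TangentSpace I x, metric x v v < 0 ∧
    ∀ w : TangentSpace I x, metric x v w = 0 → w ≠ 0 → 0 < metric x w w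
  metric_continuous : Continuous fun x : M ↦
    TotalSpace.mk' (EuclideanSpace ℝ (Fin N) →L[ℝ] EuclideanSpace ℝ (Fin N) →L[ℝ] ℝ) x (metric x)
  /-- The vector field that fixes the time orientation. -/
  timeField : ∀ x : M, TangentSpace I x
  timeField_continuous : Continuous fun x : M ↦ (⟨x, timeField x⟩ : TangentBundle I M)
  timeField_timelike : ∀ x : M, metric x (timeField x) (timeField x) < 0

namespace ContinuousSpacetime

variable {N : ℕ} {H : Type*} [TopologicalSpace H]
  {I : ModelWithCorners ℝ (EuclideanSpace ℝ (Fin N)) H}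
  {M : Type*} [MetricSpace M] [ChartedSpace H M] [IsManifold I ∞ M]
  (S : ContinuousSpacetime I M)

/-- A nonzero vector `v` is future directed causal if `g(v,v) ≤ 0` and it lies in the same half
cone as the time orientation. (The last inequality forces `v ≠ 0`.) -/
def FutureCausal {x : M} (v : TangentSpace I x) : Prop :=
  S.metric x v v ≤ 0 ∧ S.metric x (S.timeField x) v < 0

/-- Future directed timelike vectors. -/
def FutureTimelike {x : M} (v : TangentSpace I x) : Prop :=
  S.metric x v v < 0 ∧ S.metric x (S.timeField x) v < 0

/-- The velocity `γ'(t)` of a curve. -/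
def velocity (I : ModelWithCorners ℝ (EuclideanSpace ℝ (Fin N)) H)
    {M : Type*} [TopologicalSpace M] [ChartedSpace H M] (γ : ℝ → M) (t : ℝ) :
    TangentSpace I (γ t) :=
  mfderiv 𝓘(ℝ, ℝ) I γ t (1 : ℝ)

/-- `γ` restricted to `[a,b]`, `a < b`, is a future directed causal curve: it is Lipschitz and its
velocity exists and is future directed causal almost everywhere. -/
def IsCausalCurve (γ : ℝ → M) (a b : ℝ) : Prop :=
  a < b ∧ (∃ K, LipschitzOnWith K γ (Icc a b)) ∧
    ∀ᵐ t ∂(volume.restrict (Icc a b)),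
      MDifferentiableAt 𝓘(ℝ, ℝ) I γ t ∧ S.FutureCausal (velocity I γ t)

/-- `γ` restricted to `[a,b]`, `a < b`, is a future directed timelike curve. -/
def IsTimelikeCurve (γ : ℝ → M) (a b : ℝ) : Prop :=
  a < b ∧ (∃ K, LipschitzOnWith K γ (Icc a b)) ∧
    ∀ᵐ t ∂(volume.restrict (Icc a b)),
      MDifferentiableAt 𝓘(ℝ, ℝ) I γ t ∧ S.FutureTimelike (velocity I γ t)

/-- The causal relation `x ≤ y`. -/
def CausalLE (x y : M) : Prop :=
  x = y ∨ ∃ (γ : ℝ → M) (a b : ℝ), S.IsCausalCurve γ a b ∧ γ a = x ∧ γ b = y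

/-- The strict causal relation `x < y`, i.e. `x ≤ y` and `x ≠ y`. -/
def CausalLT (x y : M) : Prop := S.CausalLE x y ∧ x ≠ y

/-- The timelike relation `x ≪ y`. -/
def TimelikeLT (x y : M) : Prop :=
  ∃ (γ : ℝ → M) (a b : ℝ), S.IsTimelikeCurve γ a b ∧ γ a = x ∧ γ b = y

/-- The causal diamond `J(x,y) = J⁺(x) ∩ J⁻(y)`. -/
def causalDiamond (x y : M) : Set M := {z | S.CausalLE x z ∧ S.CausalLE z y}

/-- The chronological diamond `I(x,y) = I⁺(x) ∩ I⁻(y)`. -/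
def timelikeDiamond (x y : M) : Set M := {z | S.TimelikeLT x z ∧ S.TimelikeLT z y}

/-- The Lorentzian length `∫ √(-g(γ',γ')) dt` of a causal curve. -/
def length (γ : ℝ → M) (a b : ℝ) : ℝ≥0∞ :=
  ∫⁻ t in Icc a b,
    ENNReal.ofReal (Real.sqrt (-(S.metric (γ t) (velocity I γ t) (velocity I γ t))))

/-- The time separation `τ(x,y)`: the supremum of the lengths of the future directed causal curves
from `x` to `y`, and `0` if there is none. -/
def timeSeparation (x y : M) : ℝ≥0∞ :=
  ⨆ (γ : ℝ → M) (a : ℝ) (b : ℝ) (_ : S.IsCausalCurve γ a b ∧ γ a = x ∧ γ b = y), S.length γ a b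

/-- The Alexandrov topology, with the sets `I(x,y)` as a subbase. -/
abbrev alexandrovTopology : TopologicalSpace M :=
  TopologicalSpace.generateFrom {s | ∃ x y : M, s = S.timelikeDiamond x y}

/-- The Alexandrov topology is the manifold topology. -/
def AlexandrovStronglyCausal : Prop :=
  S.alexandrovTopology = (inferInstance : TopologicalSpace M)

/-- Every neighbourhood `U` of a point contains a smaller neighbourhood `V` such that causal curves
with endpoints in `V` do not leave `U`. -/
def StronglyCausal : Prop :=
  ∀ (x : M), ∀ U ∈ 𝓝 x, ∃ V ∈ 𝓝 x, ∀ (γ : ℝ → M) (a b : ℝ),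
    S.IsCausalCurve γ a b → γ a ∈ V → γ b ∈ V → ∀ t ∈ Icc a b, γ t ∈ U

/-- The normalization `ω_N = π^((N-1)/2) / (N Γ((N+1)/2) 2^(N-1))`. -/
def omega (N : ℕ) : ℝ :=
  Real.pi ^ (((N : ℝ) - 1) / 2) /
    ((N : ℝ) * Real.Gamma (((N : ℝ) + 1) / 2) * (2 : ℝ) ^ ((N : ℝ) - 1))

open Classical in
/-- `ρ_N(J(x,y)) = ω_N τ(x,y)^N`, and `∞` if `τ(x,y) = ∞`; here `N` is the dimension. -/
def rho (x y : M) : ℝ≥0∞ :=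
  if S.timeSeparation x y = (⊤ : ℝ≥0∞) then ⊤
  else ENNReal.ofReal (omega N) * S.timeSeparation x y ^ N

/-- The members of the covering family `{J(x,y) | x < y} ∪ {∅}`: a pair `x < y` stands for the
diamond `J(x,y)` and `none` stands for the empty set. -/
abbrev CoverIndex : Type _ := Option {p : M × M // S.CausalLT p.1 p.2}

variable {S} in
/-- The set that belongs to an index. -/
def CoverIndex.toSet : S.CoverIndex → Set M
  | none => ∅
  | some p => S.causalDiamond p.1.1 p.1.2

variable {S} in
/-- The weight `ρ_N` of a member of the covering family, with `ρ_N(∅) = 0`. -/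
def CoverIndex.weight : S.CoverIndex → ℝ≥0∞
  | none => 0
  | some p => S.rho p.1.1 p.1.2

variable {S} in
/-- The distance `d(x,y)` of the vertices of `J(x,y)` is smaller than `δ` (no condition on `∅`). -/
def CoverIndex.VertexDistLT (δ : ℝ) : S.CoverIndex → Prop
  | none => True
  | some p => dist p.1.1 p.1.2 < δ

/-- `𝒱^N_δ(A)`: coverings by causal diamonds of diameter less than `δ`. -/
def timelikeHausdorffDelta (δ : ℝ) (A : Set M) : ℝ≥0∞ :=
  ⨅ (c : ℕ → S.CoverIndex)
    (_ : (∀ i, Metric.ediam (c i).toSet < ENNReal.ofReal δ) ∧ A ⊆ ⋃ i, (c i).toSet),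
    ∑' i, (c i).weight

/-- The timelike Hausdorff measure `𝒱^N(A) = sup_{δ>0} 𝒱^N_δ(A)`, with `N` the dimension. -/
def timelikeHausdorff (A : Set M) : ℝ≥0∞ :=
  ⨆ (δ : ℝ) (_ : 0 < δ), S.timelikeHausdorffDelta δ A

/-- `𝒲^N_δ(A)`: coverings by causal diamonds whose vertices have distance less than `δ`. -/
def vertexHausdorffDelta (δ : ℝ) (A : Set M) : ℝ≥0∞ :=
  ⨅ (c : ℕ → S.CoverIndex)
    (_ : (∀ i, (c i).VertexDistLT δ) ∧ A ⊆ ⋃ i, (c i).toSet),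
    ∑' i, (c i).weight

/-- The modified timelike Hausdorff measure `𝒲^N(A) = sup_{δ>0} 𝒲^N_δ(A)`. -/
def vertexHausdorff (A : Set M) : ℝ≥0∞ :=
  ⨆ (δ : ℝ) (_ : 0 < δ), S.vertexHausdorffDelta δ A

end ContinuousSpacetime

end

/-! For `x < y` both vertices lie in `J(x,y)`, so a small diameter forces close vertices and `𝒲 ≤
𝒱`. The converse needs only the uniform diameter bound
`StronglyCausal.exists_ediam_causalDiamond_le`. Gluing two causal curves puts any point of `J(x,y)`
other than `x`, `y` on a causal curve from `x` to `y`. Strong causality therefore confines diamonds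
with vertices in a small open set to a small ball, and a Lebesgue number of the cover by such sets
gives one `δ` for all of `M`. The Alexandrov hypothesis is degenerate on a compact spacetime: it
leaves only one point, where strong causality is trivial. -/

namespace ContinuousSpacetime

variable {N : ℕ} {H : Type*} [TopologicalSpace H]
  {I : ModelWithCorners ℝ (EuclideanSpace ℝ (Fin N)) H}

/-! ### Curves with velocity in a family `P`, covering causal and timelike curves at once. -/

section Curves

variable {M : Type*} [MetricSpace M] [ChartedSpace H M]

/-- `γ` is Lipschitz on `[a,b]`, `a < b`, and its velocity satisfies `P` almost everywhere. -/
def IsCurveWithVelocityIn (P : ∀ x : M, TangentSpace I x → Prop) (γ : ℝ → M) (a b : ℝ) : Prop :=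
  a < b ∧ (∃ K, LipschitzOnWith K γ (Icc a b)) ∧
    ∀ᵐ t ∂(volume.restrict (Icc a b)),
      MDifferentiableAt 𝓘(ℝ, ℝ) I γ t ∧ P (γ t) (velocity I γ t)

/-- `γ` is differentiable at `t` with velocity in `P`. -/
def HasVelocityIn (P : ∀ x : M, TangentSpace I x → Prop) (γ : ℝ → M) (t : ℝ) : Prop :=
  MDifferentiableAt 𝓘(ℝ, ℝ) I γ t ∧ P (γ t) (velocity I γ t)

variable {P : ∀ x : M, TangentSpace I x → Prop}

theorem HasVelocityIn.of_hasMFDerivAt {γ : ℝ → M} {t : ℝ}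
    {L : TangentSpace 𝓘(ℝ, ℝ) t →L[ℝ] TangentSpace I (γ t)}
    (h : HasMFDerivAt 𝓘(ℝ, ℝ) I γ t L) (hP : P (γ t) (L (1 : ℝ))) : HasVelocityIn P γ t := by
  refine ⟨h.mdifferentiableAt, ?_⟩
  unfold velocity
  rw [h.mfderiv]
  exact hP

theorem HasVelocityIn.congr {γ η : ℝ → M} {t : ℝ} (h : HasVelocityIn P γ t)
    (hη : η =ᶠ[𝓝 t] γ) : HasVelocityIn P η t := by
  have hd := h.1.hasMFDerivAt.congr_of_eventuallyEq hη
  refine .of_hasMFDerivAt (L := mfderiv 𝓘(ℝ, ℝ) I γ t) hd ?_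
  -- All tangent spaces unfold to the same model space, so `P` is carried along the equality of base
  -- points with the vector fixed.
  have key : ∀ (y : M) (_ : y = γ t) (v : EuclideanSpace ℝ (Fin N)),
      P (γ t) v → P y v := by
    rintro y rfl v hv
    exact hv
  exact key _ hη.eq_of_nhds _ h.2

theorem HasVelocityIn.comp_add_const {γ : ℝ → M} {t s : ℝ} (h : HasVelocityIn P γ (t + s)) :
    HasVelocityIn P (fun u ↦ γ (u + s)) t := by
  have hs : HasMFDerivAt 𝓘(ℝ, ℝ) 𝓘(ℝ, ℝ) (fun u : ℝ ↦ u + s) t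
      (ContinuousLinearMap.id ℝ ℝ) :=
    ((hasFDerivAt_id (𝕜 := ℝ) t).add_const s).hasMFDerivAt
  exact .of_hasMFDerivAt (h.1.hasMFDerivAt.comp t hs) h.2

theorem IsCurveWithVelocityIn.mono {γ : ℝ → M} {a b a' b' : ℝ}
    (h : IsCurveWithVelocityIn P γ a b) (ha : a ≤ a') (hab : a' < b') (hb : b' ≤ b) :
    IsCurveWithVelocityIn P γ a' b' := by
  obtain ⟨-, ⟨K, hK⟩, hP⟩ := h
  have hsub : Icc a' b' ⊆ Icc a b := Icc_subset_Icc ha hb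
  exact ⟨hab, ⟨K, hK.mono hsub⟩, ae_restrict_of_ae_restrict_of_subset hsub hP⟩

theorem lipschitzOnWith_Icc_union {γ : ℝ → M} {a b c : ℝ} {K L : NNReal}
    (hab : a ≤ b) (hbc : b ≤ c)
    (hK : LipschitzOnWith K γ (Icc a b)) (hL : LipschitzOnWith L γ (Icc b c)) :
    LipschitzOnWith (max K L) γ (Icc a c) := by
  have hK' := hK.weaken (le_max_left K L)
  have hL' := hL.weaken (le_max_right K L)
  have key : ∀ s ∈ Icc a c, ∀ t ∈ Icc a c, s ≤ t →
      dist (γ s) (γ t) ≤ (max K L : NNReal) * dist s t := by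
    intro s hs t ht hst
    rcases le_total t b with htb | hbt
    · exact hK'.dist_le_mul s ⟨hs.1, hst.trans htb⟩ t ⟨ht.1, htb⟩
    rcases le_total b s with hbs | hsb
    · exact hL'.dist_le_mul s ⟨hbs, hs.2⟩ t ⟨hbt, ht.2⟩
    have h1 := hK'.dist_le_mul s ⟨hs.1, hsb⟩ b ⟨hab, le_rfl⟩
    have h2 := hL'.dist_le_mul b ⟨le_rfl, hbc⟩ t ⟨hbt, ht.2⟩
    have h3 : dist s t = dist s b + dist b t := by
      rw [dist_comm s t, dist_comm s b, dist_comm b t, Real.dist_eq, Real.dist_eq, Real.dist_eq,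
        abs_of_nonneg (sub_nonneg.2 hst), abs_of_nonneg (sub_nonneg.2 hsb),
        abs_of_nonneg (sub_nonneg.2 hbt)]
      ring
    rw [h3, mul_add]
    exact (dist_triangle _ (γ b) _).trans (add_le_add h1 h2)
  refine LipschitzOnWith.of_dist_le_mul fun s hs t ht ↦ ?_
  rcases le_total s t with hst | hts
  · exact key s hs t ht hst
  · rw [dist_comm, dist_comm s t]
    exact key t ht s hs hts

/-- The second curve is translated in time to start at `b`. A possible corner there is a null set,
and away from it the glued curve agrees locally with one of the pieces. The junction is recorded
because diamonds need the intermediate point. -/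
theorem IsCurveWithVelocityIn.concat {γ η : ℝ → M} {a b c d : ℝ}
    (hγ : IsCurveWithVelocityIn P γ a b) (hη : IsCurveWithVelocityIn P η c d)
    (hbc : γ b = η c) :
    ∃ (ζ : ℝ → M) (e : ℝ), IsCurveWithVelocityIn P ζ a e ∧ b ∈ Icc a e ∧
      ζ a = γ a ∧ ζ b = γ b ∧ ζ e = η d := by
  obtain ⟨hab, ⟨K, hK⟩, hγP⟩ := hγ
  obtain ⟨hcd, ⟨L, hL⟩, hηP⟩ := hη
  set s := c - b with hs
  set ζ : ℝ → M := fun t ↦ if t ≤ b then γ t else η (t + s) with hζ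
  have hleft : ∀ t ≤ b, ζ t = γ t := fun t ht ↦ if_pos ht
  have hright : ∀ t, b ≤ t → ζ t = η (t + s) := by
    intro t ht
    rcases ht.eq_or_lt with rfl | ht
    · rw [hleft _ le_rfl, hbc, hs]
      congr 1
      ring
    · exact if_neg ht.not_ge
  have hbe : b < d - s := by rw [hs]; linarith
  refine ⟨ζ, d - s, ⟨hab.trans hbe, ⟨max K L, ?_⟩, ?_⟩, ⟨hab.le, hbe.le⟩, hleft _ hab.le,
    hleft _ le_rfl, by rw [hright _ hbe.le, sub_add_cancel]⟩
  · refine lipschitzOnWith_Icc_union hab.le hbe.le ?_ ?_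
    · refine LipschitzOnWith.of_dist_le_mul fun t ht u hu ↦ ?_
      rw [hleft t ht.2, hleft u hu.2]
      exact hK.dist_le_mul t ht u hu
    refine LipschitzOnWith.of_dist_le_mul fun t ht u hu ↦ ?_
    rw [hright t ht.1, hright u hu.1, ← dist_add_right t u s]
    refine hL.dist_le_mul _ ⟨?_, ?_⟩ _ ⟨?_, ?_⟩ <;> linarith [ht.1, ht.2, hu.1, hu.2]
  · rw [ae_restrict_iff' measurableSet_Icc] at hγP hηP ⊢
    have hηP' : ∀ᵐ t : ℝ, t + s ∈ Icc c d → HasVelocityIn P η (t + s) :=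
      (measurePreserving_add_right volume s).quasiMeasurePreserving.ae hηP
    have hne : ∀ᵐ t : ℝ, t ≠ b := Measure.ae_ne volume b
    filter_upwards [hγP, hηP', hne] with t h1 h2 h3 ht
    change HasVelocityIn P ζ t
    rcases lt_or_gt_of_ne h3 with htb | hbt
    · refine HasVelocityIn.congr (h1 ⟨ht.1, htb.le⟩) ?_
      filter_upwards [Iio_mem_nhds htb] with u hu using hleft u hu.le
    · refine HasVelocityIn.congr (HasVelocityIn.comp_add_const (h2 ⟨?_, ?_⟩)) ?_
      · linarith
      · linarith [ht.2]
      · filter_upwards [Ioi_mem_nhds hbt] with u hu using hright u hu.le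

/-- A curve whose velocity is almost everywhere nonzero leaves its initial point. -/
theorem IsCurveWithVelocityIn.exists_ne {γ : ℝ → M} {a b : ℝ}
    (hγ : IsCurveWithVelocityIn P γ a b) (hP : ∀ x, ¬ P x 0) (p : M) :
    ∃ t ∈ Ioo a b, γ t ≠ p := by
  by_contra! hconst
  have hae : ∀ᵐ t ∂(volume.restrict (Ioo a b)), HasVelocityIn P γ t :=
    ae_restrict_of_ae_restrict_of_subset Ioo_subset_Icc_self hγ.2.2
  -- The open interval has positive measure, so some interior time has a velocity in `P`; a locally
  -- constant curve has velocity `0` there.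
  have hne : (ae (volume.restrict (Ioo a b))).NeBot := by
    rw [ae_neBot, Ne, Measure.restrict_eq_zero, Real.volume_Ioo]
    simpa using hγ.1
  obtain ⟨t, ht, htI⟩ := (hae.and (ae_restrict_mem measurableSet_Ioo)).exists
  have heq : (fun _ ↦ p) =ᶠ[𝓝 t] γ := by
    filter_upwards [isOpen_Ioo.mem_nhds htI] with u hu using (hconst u hu).symm
  have h := (ht.congr heq).2
  have h0 : velocity I (fun _ : ℝ ↦ p) t = 0 := by
    unfold velocity
    rw [mfderiv_const]
    rfl
  rw [h0] at h
  exact hP p h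

end Curves

variable {M : Type*} [MetricSpace M] [ChartedSpace H M] [IsManifold I ∞ M]
  (S : ContinuousSpacetime I M)

/-! ### Gluing causal and timelike curves; the Alexandrov topology. -/

theorem TimelikeLT.trans {x y z : M} (hxy : S.TimelikeLT x y) (hyz : S.TimelikeLT y z) :
    S.TimelikeLT x z := by
  obtain ⟨γ, a, b, hγ, rfl, rfl⟩ := hxy
  obtain ⟨η, c, d, hη, hc, rfl⟩ := hyz
  obtain ⟨ζ, e, hζ, -, ha, -, he⟩ := IsCurveWithVelocityIn.concat
    (P := fun _ v ↦ S.FutureTimelike v) hγ hη hc.symm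
  exact ⟨ζ, a, e, hζ, ha, he⟩

/-- A closed timelike curve passes through a second point. -/
theorem exists_ne_timelikeLT_of_timelikeLT_self {p : M} (hp : S.TimelikeLT p p) :
    ∃ q, q ≠ p ∧ S.TimelikeLT p q ∧ S.TimelikeLT q p := by
  obtain ⟨γ, a, b, hγ, ha, hb⟩ := hp
  have hγ' : IsCurveWithVelocityIn (fun _ v ↦ S.FutureTimelike v) γ a b := hγ
  obtain ⟨t, ht, hne⟩ := hγ'.exists_ne (fun x h ↦ by simpa using h.1) p
  exact ⟨γ t, hne, ⟨γ, a, t, hγ'.mono le_rfl ht.1 ht.2.le, ha, rfl⟩,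
    ⟨γ, t, b, hγ'.mono ht.1.le ht.2 le_rfl, rfl, hb⟩⟩

/-- A point of the diamond is either a vertex, covered by `V ⊆ U`, or the junction of two causal
curves that glue to one with both endpoints in `V`. -/
theorem causalDiamond_subset_of_causallyConvex {U V : Set M} (hVU : V ⊆ U)
    (hV : ∀ (γ : ℝ → M) (a b : ℝ), S.IsCausalCurve γ a b → γ a ∈ V → γ b ∈ V →
      ∀ t ∈ Icc a b, γ t ∈ U) {x y : M} (hx : x ∈ V) (hy : y ∈ V) :
    S.causalDiamond x y ⊆ U := by
  rintro z ⟨rfl | ⟨γ, a, b, hγ, rfl, rfl⟩, hzy⟩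
  · exact hVU hx
  obtain rfl | ⟨η, c, d, hη, hc, rfl⟩ := hzy
  · exact hVU hy
  obtain ⟨ζ, e, hζ, hb, hζa, hζb, hζe⟩ := IsCurveWithVelocityIn.concat
    (P := fun _ v ↦ S.FutureCausal v) hγ hη hc.symm
  rw [← hζb]
  exact hV ζ a e hζ (hζa ▸ hx) (hζe ▸ hy) b hb

/-- On a compact spacetime, the Alexandrov topology is the manifold topology only if there is just
one point: otherwise finitely many chronological diamonds cover the spacetime, hence there is a
closed timelike curve, and the Alexandrov topology does not separate its points. -/
theorem AlexandrovStronglyCausal.subsingleton [CompactSpace M]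
    (h : S.AlexandrovStronglyCausal) : Subsingleton M := by
  by_contra hM
  rw [not_subsingleton_iff_nontrivial] at hM
  have hnhds : ∀ p : M, 𝓝 p = ⨅ s ∈ {s | p ∈ s ∧ s ∈ {s | ∃ x y : M, s = S.timelikeDiamond x y}},
      Filter.principal s := fun p ↦
    (congrArg (fun t ↦ @nhds M t p) h).symm.trans TopologicalSpace.nhds_generateFrom
  have hopen : ∀ x y : M, IsOpen (S.timelikeDiamond x y) := fun x y ↦ by
    have : IsOpen[S.alexandrovTopology] (S.timelikeDiamond x y) :=
      TopologicalSpace.isOpen_generateFrom_of_mem ⟨x, y, rfl⟩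
    rwa [h] at this
  -- a point `q` that lies in every diamond around `p` cannot be separated from `p`
  have hsep : ∀ p q : M, q ≠ p →
      ∃ x y : M, p ∈ S.timelikeDiamond x y ∧ q ∉ S.timelikeDiamond x y := by
    intro p q hqp
    by_contra! hall
    -- Then `q` would lie in every neighbourhood of `p`, which the metric topology excludes.
    have hle : pure q ≤ 𝓝 p := by
      rw [hnhds p]
      refine le_iInf₂ ?_
      rintro s ⟨hps, x, y, rfl⟩
      simpa using hall x y hps
    exact hqp (pure_le_nhds_iff.1 hle)
  have hcov : ∀ p : M, ∃ x y : M, p ∈ S.timelikeDiamond x y := by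
    intro p
    obtain ⟨q, hq⟩ := exists_ne p
    obtain ⟨x, y, hp, -⟩ := hsep p q hq
    exact ⟨x, y, hp⟩
  choose x y hxy using hcov
  obtain ⟨t, ht⟩ := isCompact_univ.elim_finite_subcover
    (fun p ↦ S.timelikeDiamond (x p) (y p)) (fun p ↦ hopen _ _)
    (fun p _ ↦ mem_iUnion.2 ⟨p, hxy p⟩)
  have hpast : ∀ q : M, ∃ p ∈ t, S.TimelikeLT (x p) q := by
    intro q
    obtain ⟨p, hp, hq⟩ := mem_iUnion₂.1 (ht (mem_univ q))
    exact ⟨p, hp, hq.1⟩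
  have hclosed : ∃ p, S.TimelikeLT p p := by
    by_contra! hirr
    -- Without closed timelike curves, `≪` would be a strict order on the finitely many lower
    -- vertices, yet each of them lies in a covering diamond and so has a predecessor among them.
    let r : t → t → Prop := fun p q ↦ S.TimelikeLT (x p) (x q)
    have : IsTrans t r := ⟨fun _ _ _ ↦ TimelikeLT.trans S⟩
    have : Std.Irrefl r := ⟨fun p ↦ hirr (x p)⟩
    obtain ⟨p₀, hp₀, -⟩ := hpast (Classical.arbitrary M)
    obtain ⟨m, -, hm⟩ := (Finite.wellFounded_of_trans_of_irrefl r).has_min univ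
      ⟨⟨p₀, hp₀⟩, mem_univ _⟩
    obtain ⟨p, hp, hlt⟩ := hpast (x m)
    exact hm ⟨p, hp⟩ (mem_univ _) hlt
  obtain ⟨p, hp⟩ := hclosed
  obtain ⟨q, hqp, hpq, hqp'⟩ := S.exists_ne_timelikeLT_of_timelikeLT_self hp
  obtain ⟨u, v, hpI, hqI⟩ := hsep p q hqp
  -- Since `p ≪ q ≪ p`, every diamond around `p` contains `q`.
  exact hqI ⟨hpI.1.trans S hpq, hqp'.trans S hpI.2⟩

theorem AlexandrovStronglyCausal.stronglyCausal [CompactSpace M]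
    (h : S.AlexandrovStronglyCausal) : S.StronglyCausal := by
  have := h.subsingleton
  intro x U hU
  refine ⟨U, hU, fun γ a b _ _ _ t _ ↦ ?_⟩
  rw [Subsingleton.elim (γ t) x]
  exact mem_of_mem_nhds hU

/-! ### Uniform smallness of diamonds and comparison of the two measures. -/

/-- The diameter of `J(x,y)` tends to `0` uniformly as `d(x,y) → 0`. -/
theorem StronglyCausal.exists_ediam_causalDiamond_le [CompactSpace M] (h : S.StronglyCausal)
    {ε : ℝ} (hε : 0 < ε) :
    ∃ δ : ℝ, 0 < δ ∧ ∀ x y : M, dist x y < δ →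
      Metric.ediam (S.causalDiamond x y) ≤ ENNReal.ofReal ε := by
  have hV : ∀ p : M, ∃ V : Set M, p ∈ V ∧ IsOpen V ∧ ∀ x ∈ V, ∀ y ∈ V,
      S.causalDiamond x y ⊆ Metric.ball p (ε / 2) := by
    intro p
    have hU := Metric.ball_mem_nhds p (half_pos hε)
    obtain ⟨V, hV, hconv⟩ := h p _ hU
    -- Intersecting with the ball provides `V ⊆ U`; the interior makes the cover open.
    refine ⟨interior (V ∩ Metric.ball p (ε / 2)),
      mem_interior_iff_mem_nhds.2 (Filter.inter_mem hV hU), isOpen_interior, fun x hx y hy ↦ ?_⟩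
    exact S.causalDiamond_subset_of_causallyConvex inter_subset_right
      (fun γ a b hγ ha hb ↦ hconv γ a b hγ ha.1 hb.1) (interior_subset hx) (interior_subset hy)
  choose V hpV hVo hVJ using hV
  obtain ⟨δ, hδ, hball⟩ := lebesgue_number_lemma_of_metric isCompact_univ hVo
    (fun p _ ↦ mem_iUnion.2 ⟨p, hpV p⟩)
  refine ⟨δ, hδ, fun x y hxy ↦ ?_⟩
  obtain ⟨p, hp⟩ := hball x (mem_univ x)
  have hsub := hVJ p x (hp (Metric.mem_ball_self hδ)) y (hp (Metric.mem_ball'.2 hxy))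
  refine Metric.ediam_le fun z hz w hw ↦ ?_
  rw [edist_dist]
  refine ENNReal.ofReal_le_ofReal ?_
  have h1 := Metric.mem_ball.1 (hsub hz)
  have h2 := Metric.mem_ball'.1 (hsub hw)
  linarith [dist_triangle z p w]

theorem CoverIndex.vertexDistLT_of_ediam_lt {δ : ℝ} {c : S.CoverIndex}
    (h : Metric.ediam c.toSet < ENNReal.ofReal δ) : c.VertexDistLT δ := by
  match c with
  | none => trivial
  | some ⟨(x, y), hxy⟩ =>
    have hle : edist x y ≤ Metric.ediam (S.causalDiamond x y) :=
      Metric.edist_le_ediam_of_mem ⟨.inl rfl, hxy.1⟩ ⟨hxy.1, .inl rfl⟩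
    have hlt := hle.trans_lt h
    rw [edist_dist] at hlt
    exact (ENNReal.ofReal_lt_ofReal_iff'.1 hlt).1

theorem vertexHausdorff_le_timelikeHausdorff (A : Set M) :
    S.vertexHausdorff A ≤ S.timelikeHausdorff A :=
  iSup₂_mono fun _ _ ↦ le_iInf₂ fun c hc ↦
    iInf₂_le c ⟨fun i ↦ CoverIndex.vertexDistLT_of_ediam_lt S (hc.1 i), hc.2⟩

theorem timelikeHausdorff_le_vertexHausdorff
    (h : ∀ ε : ℝ, 0 < ε → ∃ δ : ℝ, 0 < δ ∧ ∀ x y : M, dist x y < δ →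
      Metric.ediam (S.causalDiamond x y) ≤ ENNReal.ofReal ε) (A : Set M) :
    S.timelikeHausdorff A ≤ S.vertexHausdorff A := by
  refine iSup₂_le fun ε hε ↦ ?_
  -- Halving turns the non-strict diameter bound into the strict one required of a cover.
  obtain ⟨δ, hδ, hδε⟩ := h (ε / 2) (half_pos hε)
  refine le_iSup₂_of_le δ hδ (le_iInf₂ fun c hc ↦ iInf₂_le c ⟨fun i ↦ ?_, hc.2⟩)
  have hlt : ENNReal.ofReal (ε / 2) < ENNReal.ofReal ε :=
    (ENNReal.ofReal_lt_ofReal_iff hε).2 (half_lt_self hε)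
  have hi := hc.1 i
  generalize c i = k at hi ⊢
  match k with
  | none => simpa [CoverIndex.toSet] using hε
  | some p => exact (hδε p.1.1 p.1.2 hi).trans_lt hlt

end ContinuousSpacetime

theorem mainTheorem5 {N : ℕ} {H : Type*} [TopologicalSpace H]
    (I : ModelWithCorners ℝ (EuclideanSpace ℝ (Fin N)) H)
    {M : Type*} [MetricSpace M] [ChartedSpace H M] [IsManifold I ∞ M]
    [CompactSpace M] [ConnectedSpace M]
    [RiemannianBundle (fun x : M ↦ TangentSpace I x)]
    [IsContinuousRiemannianBundle (EuclideanSpace ℝ (Fin N)) (fun x : M ↦ TangentSpace I x)]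
    [IsRiemannianManifold I M]
    (S : ContinuousSpacetime I M)
    (hS : S.StronglyCausal ∨ S.AlexandrovStronglyCausal) :
    (∀ A : Set M, S.vertexHausdorff A = S.timelikeHausdorff A) ∧
    (∀ ε : ℝ, 0 < ε → ∃ δ : ℝ, 0 < δ ∧ ∀ x y : M, dist x y < δ →
      Metric.ediam (S.causalDiamond x y) ≤ ENNReal.ofReal ε) := by
  have h : S.StronglyCausal := hS.elim id fun h ↦ h.stronglyCausal
  have hdiam := fun (ε : ℝ) (hε : 0 < ε) ↦ h.exists_ediam_causalDiamond_le S hε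
  exact ⟨fun A ↦ (S.vertexHausdorff_le_timelikeHausdorff A).antisymm
    (S.timelikeHausdorff_le_vertexHausdorff hdiam A), hdiam⟩
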